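/- A partially ordered group is a (not necessarily commutative) group $G$ with a partial order such that $a\le b$ implies $sat\le sbt$ for all $a,b,s,t\in G$; an $\ell$-group is a partially ordered group whose order is a lattice order. An $\ell$-group is representable if it is a subdirect product of totally ordered groups, and Abelian if its underlying group is Abelian. Let $\mathsf V$ be the variety of all $\ell$-groups, or of representable $\ell$-groups, or of Abelian $\ell$-groups. For a partially ordered group $G$ let $\eta\colon G\to F_{\mathsf V}(G)$ be the free $\ell$-group over $G$ in $\mathsf V$: $F_{\mathsf V}(G)\in\mathsf V$, $\eta$ is an order-preserving group homomorphism, and each order-preserving group homomorphism $p\colon G\to H$ with $H\in\mathsf V$ is of the form $p=h\circ\eta$ for exactly one $\ell$-homomorphism (group and lattice homomorphism) $h\colon F_{\mathsf V}(G)\to H$. For an $\ell$-group $H$, a prime subgroup is a proper subgroup $\mathfrak p\subsetneq H$ that is a sublattice of $H$ and order convex, and whose cosets are totally ordered by: $\mathfrak p x\le\mathfrak p y$ if and only if $x\le ty$ for some $t\in\mathfrak p$. Let $\operatorname{Spec}H$ be the set of prime subgroups, with the topology whose open sets are the sets $\{\mathfrak p\in\operatorname{Spec}H\mid A\not\subseteq\mathfrak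 p\}$ for arbitrary subsets $A\subseteq H$, and let $\operatorname{Min}H\subseteq\operatorname{Spec}H$ be the subspace of the inclusion-minimal prime subgroups. Theorem. Let $\mathsf V$ be the variety of all, of representable, or of Abelian $\ell$-groups. For every partially ordered group $G$, the minimal spectrum $\operatorname{Min}F_{\mathsf V}(G)$ is compact. -/

import Mathlib

universe u v w

namespace LGrp

/-! A partially ordered group is a group `G` with a partial order such that left and right
translations are monotone: `[Group G] [PartialOrder G] [MulLeftMono G] [MulRightMono G]`.
A lattice-ordered group is the same with `[Lattice H]` in place of `[PartialOrder H]`.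
Groups are written multiplicatively and need not be commutative. -/

/-- `f` is an ℓ-homomorphism: a group homomorphism that preserves binary joins and meets. -/
structure IsLHom {H : Type u} {K : Type v} [Group H] [Lattice H] [Group K] [Lattice K]
    (f : H →* K) : Prop where
  map_sup : ∀ x y, f (x ⊔ y) = f x ⊔ f y
  map_inf : ∀ x y, f (x ⊓ y) = f x ⊓ f y

/-- An ℓ-group is representable if it is (isomorphic to) a subdirect product of totally ordered
groups: it admits a jointly injective family of surjective ℓ-homomorphisms onto totally ordered
groups. -/
def IsRepresentable (H : Type u) [Group H] [Lattice H] : Prop :=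
  ∃ (ι : Type u) (T : ι → Type u) (_ : ∀ i, Group (T i)) (_ : ∀ i, LinearOrder (T i))
    (_ : ∀ i, MulLeftMono (T i)) (_ : ∀ i, MulRightMono (T i)) (f : ∀ i, H →* T i),
    (∀ i, IsLHom (f i)) ∧ (∀ i, Function.Surjective (f i)) ∧
      ∀ x y, (∀ i, f i x = f i y) → x = y

/-- An ℓ-group is Abelian if its underlying group is. -/
def IsAbelian (H : Type u) [Group H] : Prop := ∀ x y : H, x * y = y * x

/-- The three varieties of ℓ-groups under consideration. -/
inductive Variety : Type
  | all
  | representable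
  | abelian

/-- Membership of an ℓ-group in the variety `V`. -/
def Variety.Mem (V : Variety) (H : Type u) [Group H] [Lattice H] : Prop :=
  match V with
  | .all => True
  | .representable => IsRepresentable H
  | .abelian => IsAbelian H

/-- The universal property of the free ℓ-group over the partially ordered group `G` in `V`:
`F` lies in `V`, `η : G → F` is a positive homomorphism, and every positive homomorphism from `G`
to an ℓ-group in `V` factors through `η` by exactly one ℓ-homomorphism. -/
structure IsFreeOver (V : Variety) {G F : Type u} [Group G] [PartialOrder G]
    [Group F] [Lattice F] (η : G →* F) : Prop where
  mem : V.Mem F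
  mono : Monotone η
  lift : ∀ (H : Type u) [Group H] [Lattice H] [MulLeftMono H] [MulRightMono H], V.Mem H →
    ∀ p : G →* H, Monotone p → ∃! h : F →* H, IsLHom h ∧ h.comp η = p

/-! ### Construction of the free ℓ-group -/

/-- Formal ℓ-group terms with generators the elements of `G`. -/
inductive Term (G : Type u) : Type u
  | of : G → Term G
  | one : Term G
  | mul : Term G → Term G → Term G
  | inv : Term G → Term G
  | sup : Term G → Term G → Term G
  | inf : Term G → Term G → Term G

/-- The value of a term under an assignment of the generators. -/
def Term.eval {G : Type u} {H : Type v} [Group H] [Lattice H] (p : G → H) : Term G → H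
  | .of g => p g
  | .one => 1
  | .mul s t => s.eval p * t.eval p
  | .inv s => (s.eval p)⁻¹
  | .sup s t => s.eval p ⊔ t.eval p
  | .inf s t => s.eval p ⊓ t.eval p

section Free

variable (V : Variety) (G : Type u) [Group G] [PartialOrder G]

/-- Two terms are identified when every positive homomorphism from `G` to an ℓ-group in `V` gives
them the same value. -/
def termSetoid : Setoid (Term G) where
  r s t := ∀ (H : Type u) [Group H] [Lattice H] [MulLeftMono H] [MulRightMono H], V.Mem H →
    ∀ p : G →* H, Monotone p → s.eval p = t.eval p
  iseqv :=
    { refl := fun _ _ _ _ _ _ _ _ _ => rfl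
      symm := fun h H _ _ _ _ hV p hp => (h H hV p hp).symm
      trans := fun h k H _ _ _ _ hV p hp => (h H hV p hp).trans (k H hV p hp) }

/-- The free ℓ-group over the partially ordered group `G` in the variety `V`. -/
def FreeLGroup : Type u := Quotient (termSetoid V G)

namespace FreeLGroup

instance : One (FreeLGroup V G) := ⟨Quotient.mk _ .one⟩

instance : Mul (FreeLGroup V G) := ⟨Quotient.map₂ .mul fun _ _ h _ _ k H _ _ _ _ hV p hp => by
  simp only [Term.eval]; rw [h H hV p hp, k H hV p hp]⟩

instance : Inv (FreeLGroup V G) := ⟨Quotient.map .inv fun _ _ h H _ _ _ _ hV p hp => by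
  simp only [Term.eval]; rw [h H hV p hp]⟩

instance : Max (FreeLGroup V G) := ⟨Quotient.map₂ .sup fun _ _ h _ _ k H _ _ _ _ hV p hp => by
  simp only [Term.eval]; rw [h H hV p hp, k H hV p hp]⟩

instance : Min (FreeLGroup V G) := ⟨Quotient.map₂ .inf fun _ _ h _ _ k H _ _ _ _ hV p hp => by
  simp only [Term.eval]; rw [h H hV p hp, k H hV p hp]⟩

instance : Group (FreeLGroup V G) :=
  Group.ofLeftAxioms
    (by
      rintro ⟨a⟩ ⟨b⟩ ⟨c⟩
      exact Quotient.sound fun H _ _ _ _ _ p _ => by simp only [Term.eval, mul_assoc])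
    (by
      rintro ⟨a⟩
      exact Quotient.sound fun H _ _ _ _ _ p _ => by simp only [Term.eval, one_mul])
    (by
      rintro ⟨a⟩
      exact Quotient.sound fun H _ _ _ _ _ p _ => by simp only [Term.eval, inv_mul_cancel])

/-- The order is the one of the lattice operations: `x ≤ y` if and only if `x ⊔ y = y`. -/
instance : Lattice (FreeLGroup V G) :=
  Lattice.mk'
    (by
      rintro ⟨a⟩ ⟨b⟩
      exact Quotient.sound fun H _ _ _ _ _ p _ => by simp only [Term.eval, sup_comm])
    (by
      rintro ⟨a⟩ ⟨b⟩ ⟨c⟩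
      exact Quotient.sound fun H _ _ _ _ _ p _ => by simp only [Term.eval, sup_assoc])
    (by
      rintro ⟨a⟩ ⟨b⟩
      exact Quotient.sound fun H _ _ _ _ _ p _ => by simp only [Term.eval, inf_comm])
    (by
      rintro ⟨a⟩ ⟨b⟩ ⟨c⟩
      exact Quotient.sound fun H _ _ _ _ _ p _ => by simp only [Term.eval, inf_assoc])
    (by
      rintro ⟨a⟩ ⟨b⟩
      exact Quotient.sound fun H _ _ _ _ _ p _ => by simp only [Term.eval, sup_inf_self])
    (by
      rintro ⟨a⟩ ⟨b⟩
      exact Quotient.sound fun H _ _ _ _ _ p _ => by simp only [Term.eval, inf_sup_self])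

instance : MulLeftMono (FreeLGroup V G) := ⟨by
  rintro ⟨c⟩ ⟨a⟩ ⟨b⟩ h
  refine sup_eq_right.mp (Quotient.sound fun H _ _ _ _ hV p hp => ?_)
  have h' := Quotient.exact (sup_eq_right.mpr h) H hV p hp
  simp only [Term.eval] at h' ⊢
  rw [← mul_sup, h']⟩

instance : MulRightMono (FreeLGroup V G) := ⟨by
  rintro ⟨c⟩ ⟨a⟩ ⟨b⟩ h
  refine sup_eq_right.mp (Quotient.sound fun H _ _ _ _ hV p hp => ?_)
  have h' := Quotient.exact (sup_eq_right.mpr h) H hV p hp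
  simp only [Term.eval] at h' ⊢
  rw [← sup_mul, h']⟩

/-- The universal map `G → FreeLGroup V G`. -/
def η : G →* FreeLGroup V G where
  toFun g := Quotient.mk _ (.of g)
  map_one' := Quotient.sound fun H _ _ _ _ _ p _ => by simp only [Term.eval, map_one]
  map_mul' a b := Quotient.sound fun H _ _ _ _ _ p _ => by simp only [Term.eval, map_mul]

variable {V G}

/-- The ℓ-homomorphism induced by a positive homomorphism `p : G → H`. -/
def lift {H : Type u} [Group H] [Lattice H] [MulLeftMono H] [MulRightMono H] (hV : V.Mem H)
    (p : G →* H) (hp : Monotone p) : FreeLGroup V G →* H where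
  toFun := Quotient.lift (Term.eval p) fun _ _ h => h H hV p hp
  map_one' := rfl
  map_mul' := by rintro ⟨a⟩ ⟨b⟩; rfl

theorem lift_isLHom {H : Type u} [Group H] [Lattice H] [MulLeftMono H] [MulRightMono H]
    (hV : V.Mem H) (p : G →* H) (hp : Monotone p) : IsLHom (lift hV p hp) where
  map_sup := by rintro ⟨a⟩ ⟨b⟩; rfl
  map_inf := by rintro ⟨a⟩ ⟨b⟩; rfl

theorem exists_lift_ne {x y : FreeLGroup V G} (hxy : x ≠ y) :
    ∃ (H : Type u) (_ : Group H) (_ : Lattice H) (_ : MulLeftMono H) (_ : MulRightMono H)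
      (hV : V.Mem H) (p : G →* H) (hp : Monotone p), lift hV p hp x ≠ lift hV p hp y := by
  obtain ⟨s⟩ := x
  obtain ⟨t⟩ := y
  by_contra! hcon
  exact hxy (Quotient.sound fun H iG iL iM iN hV p hp =>
    hcon H iG iL iM iN hV p hp)

theorem exists_chain_ne {x y : FreeLGroup Variety.representable G} (hxy : x ≠ y) :
    ∃ (T : Type u) (_ : Group T) (_ : LinearOrder T) (_ : MulLeftMono T) (_ : MulRightMono T)
      (f : FreeLGroup Variety.representable G →* T),
      IsLHom f ∧ Function.Surjective f ∧ f x ≠ f y := by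
  obtain ⟨H, _, _, _, _, hV, p, hp, hne⟩ := exists_lift_ne hxy
  obtain ⟨ι, T, _, _, _, _, f, hf, -, hinj⟩ := id hV
  have hex : ∃ i, f i (lift hV p hp x) ≠ f i (lift hV p hp y) := by
    by_contra! hcon
    exact hne (hinj _ _ hcon)
  obtain ⟨i, hi⟩ := hex
  let k : FreeLGroup Variety.representable G →* T i := (f i).comp (lift hV p hp)
  have hk : IsLHom k :=
    ⟨fun a b => by simp [k, (lift_isLHom hV p hp).map_sup, (hf i).map_sup],
      fun a b => by simp [k, (lift_isLHom hV p hp).map_inf, (hf i).map_inf]⟩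
  refine ⟨k.range, inferInstance, inferInstance, ⟨?_⟩, ⟨?_⟩, k.rangeRestrict, ⟨?_, ?_⟩,
    k.rangeRestrict_surjective, ?_⟩
  · intro c a b h
    exact mul_le_mul_right (show (a : T i) ≤ b from h) (c : T i)
  · intro c a b h
    exact mul_le_mul_left (show (a : T i) ≤ b from h) (c : T i)
  · intro a b
    apply Subtype.ext
    rw [(Subtype.mono_coe (· ∈ k.range)).map_sup]
    exact hk.map_sup a b
  · intro a b
    apply Subtype.ext
    rw [(Subtype.mono_coe (· ∈ k.range)).map_inf]
    exact hk.map_inf a b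
  · intro h
    exact hi (congrArg Subtype.val h)

theorem mem_variety : V.Mem (FreeLGroup V G) := by
  cases V with
  | all => trivial
  | representable =>
    have key := fun q : {q : FreeLGroup Variety.representable G ×
      FreeLGroup Variety.representable G // q.1 ≠ q.2} => exists_chain_ne q.2
    choose T i1 i2 i3 i4 f h1 h2 h3 using key
    refine ⟨_, T, i1, i2, i3, i4, f, h1, h2, fun x y hxy => ?_⟩
    by_contra hne
    exact h3 ⟨(x, y), hne⟩ (hxy _)
  | abelian =>
    rintro ⟨a⟩ ⟨b⟩
    exact Quotient.sound fun H _ _ _ _ hV p hp => hV _ _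

/-- `FreeLGroup V G`, with the map `η`, has the universal property of the free ℓ-group. -/
theorem isFreeOver : IsFreeOver V (η V G) where
  mem := mem_variety
  mono := by
    intro a b hab
    refine sup_eq_right.mp (Quotient.sound fun H _ _ _ _ hV p hp => ?_)
    simpa only [Term.eval, sup_eq_right] using hp hab
  lift := by
    intro H _ _ _ _ hV p hp
    refine ⟨lift hV p hp, ⟨lift_isLHom hV p hp, rfl⟩, ?_⟩
    rintro h ⟨hh, hc⟩
    have key : ∀ t : Term G, h (Quotient.mk _ t) = t.eval p := by
      intro t
      induction t with
      | of g => exact DFunLike.congr_fun hc g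
      | one => exact map_one h
      | mul s t hs ht => exact (map_mul h _ _).trans (congrArg₂ _ hs ht)
      | inv s hs => exact (map_inv h _).trans (congrArg _ hs)
      | sup s t hs ht => exact (hh.map_sup _ _).trans (congrArg₂ _ hs ht)
      | inf s t hs ht => exact (hh.map_inf _ _).trans (congrArg₂ _ hs ht)
    ext ⟨t⟩
    exact key t

end FreeLGroup

end Free

/-! ### Spectra -/

section Spectrum

variable {H : Type u} [Group H] [Lattice H]

/-- A convex ℓ-subgroup: an order convex sublattice subgroup. -/
structure IsConvexLSubgroup (K : Subgroup H) : Prop where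
  sup_mem : ∀ {x y}, x ∈ K → y ∈ K → x ⊔ y ∈ K
  inf_mem : ∀ {x y}, x ∈ K → y ∈ K → x ⊓ y ∈ K
  convex : ∀ {x y z}, x ∈ K → z ∈ K → x ≤ y → y ≤ z → y ∈ K

/-- The order of the cosets `K x` and `K y`: `K x ≤ K y` iff `x ≤ t y` for some `t ∈ K`. -/
def CosetLE (K : Subgroup H) (x y : H) : Prop := ∃ t ∈ K, x ≤ t * y

/-- A prime subgroup: a proper convex ℓ-subgroup whose cosets are totally ordered. -/
structure IsPrimeSubgroup (K : Subgroup H) : Prop extends IsConvexLSubgroup K where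
  proper : K ≠ ⊤
  total : ∀ x y, CosetLE K x y ∨ CosetLE K y x

variable (H)

/-- The set of prime subgroups of `H`. -/
def Spec : Type u := {K : Subgroup H // IsPrimeSubgroup K}

variable {H}

/-- Prime subgroups are ordered by inclusion. -/
instance : PartialOrder (Spec H) := PartialOrder.lift (fun 𝔭 : Spec H => 𝔭.1) Subtype.val_injective

/-- The set of prime subgroups that do not include `A`. -/
def Spec.supp (A : Set H) : Set (Spec H) := {𝔭 | ¬ A ⊆ (𝔭.1 : Set H)}

variable [MulLeftMono H] [MulRightMono H]

theorem IsConvexLSubgroup.mabs_mem_iff {K : Subgroup H} (hK : IsConvexLSubgroup K) {x : H} :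
    |x|ₘ ∈ K ↔ x ∈ K := by
  refine ⟨fun h => hK.convex (K.inv_mem h) h ?_ (le_mabs_self x),
    fun h => hK.sup_mem h (K.inv_mem h)⟩
  exact inv_le_of_inv_le' (inv_le_mabs x)

theorem IsPrimeSubgroup.inf_mabs_mem_iff {K : Subgroup H} (hK : IsPrimeSubgroup K) {x y : H} :
    |x|ₘ ⊓ |y|ₘ ∈ K ↔ x ∈ K ∨ y ∈ K := by
  have aux : ∀ a b : H, |a|ₘ ⊓ |b|ₘ ∈ K → CosetLE K |a|ₘ |b|ₘ → a ∈ K := by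
    rintro a b hab ⟨t, ht, hle⟩
    refine hK.mabs_mem_iff.mp
      (hK.convex K.one_mem (K.mul_mem (hK.sup_mem ht K.one_mem) hab) (one_le_mabs a) ?_)
    rw [mul_inf]
    refine le_inf ?_ (hle.trans (mul_le_mul_left le_sup_left _))
    exact le_mul_of_one_le_left' le_sup_right
  constructor
  · intro h
    rcases hK.total |x|ₘ |y|ₘ with hxy | hyx
    · exact Or.inl (aux x y h hxy)
    · exact Or.inr (aux y x (by rwa [inf_comm]) hyx)
  · have h1 : (1 : H) ≤ |x|ₘ ⊓ |y|ₘ := le_inf (one_le_mabs x) (one_le_mabs y)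
    rintro (h | h)
    · exact hK.convex K.one_mem (hK.mabs_mem_iff.mpr h) h1 inf_le_left
    · exact hK.convex K.one_mem (hK.mabs_mem_iff.mpr h) h1 inf_le_right

/-- The spectral (Zariski) topology: the open sets are exactly the sets `Spec.supp A`, for
arbitrary subsets `A` of `H`. -/
instance : TopologicalSpace (Spec H) where
  IsOpen U := ∃ A : Set H, U = Spec.supp A
  isOpen_univ := ⟨Set.univ, by
    symm
    rw [Set.eq_univ_iff_forall]
    intro 𝔭 h
    exact 𝔭.2.proper (top_le_iff.mp fun x _ => h (Set.mem_univ x))⟩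
  isOpen_inter := by
    rintro _ _ ⟨A, rfl⟩ ⟨B, rfl⟩
    refine ⟨{z | ∃ a ∈ A, ∃ b ∈ B, z = |a|ₘ ⊓ |b|ₘ}, ?_⟩
    ext 𝔭
    simp only [Spec.supp, Set.mem_inter_iff, Set.mem_ofPred_eq, Set.not_subset, SetLike.mem_coe]
    constructor
    · rintro ⟨⟨a, ha, ha'⟩, b, hb, hb'⟩
      refine ⟨_, ⟨a, ha, b, hb, rfl⟩, fun h => ?_⟩
      rcases 𝔭.2.inf_mabs_mem_iff.mp h with h | h
      · exact ha' h
      · exact hb' h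
    · rintro ⟨_, ⟨a, ha, b, hb, rfl⟩, h⟩
      rw [𝔭.2.inf_mabs_mem_iff, not_or] at h
      exact ⟨⟨a, ha, h.1⟩, b, hb, h.2⟩
  isOpen_sUnion := by
    intro S hS
    refine ⟨⋃₀ {A | Spec.supp A ∈ S}, ?_⟩
    ext 𝔭
    constructor
    · rintro ⟨U, hU, hp⟩
      obtain ⟨A, rfl⟩ := hS U hU
      exact fun h => hp fun a ha => h ⟨A, hU, ha⟩
    · intro h
      obtain ⟨a, ⟨A, hA, ha⟩, hap⟩ := Set.not_subset.mp h
      exact ⟨_, hA, fun h' => hap (h' ha)⟩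

variable (H)

/-- The minimal spectrum: the inclusion-minimal prime subgroups, with the subspace topology. -/
abbrev MinSpec : Type u := {𝔭 : Spec H // IsMin 𝔭}

end Spectrum

end LGrp

/-! A prime subgroup of the free ℓ-group `F` is minimal exactly when it contains no generator
`η g ≠ 1`. On the one hand, let `K` be prime and `η g ≠ 1`, and choose a prime `Q` avoiding `η g`.
The chains attached to `K` and `Q` (the chains of cosets, on which `F` acts, for the variety of all
ℓ-groups; totally ordered quotients of `F` otherwise) have a lexicographic product, and the
universal property yields an action of `F` on it, or a homomorphism into it, whose first component
is that of `K`, while `η g` moves the second one; so some prime below `K` avoids `η g`. On the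
other hand, modulo a prime subgroup every element of `F` agrees with some `η g`, so a prime below
`𝔭` is equal to `𝔭` if no `η g ≠ 1` lies in `𝔭`. The primes disjoint from a given nonempty set are
closed under ultralimits, hence form a compact space. -/

namespace LGrp

section LHom

variable {H : Type u} {K : Type v} {L : Type w} [Group H] [Lattice H] [Group K] [Lattice K]
  [Group L] [Lattice L]

theorem IsLHom.comp {g : K →* L} {f : H →* K} (hg : IsLHom g) (hf : IsLHom f) :
    IsLHom (g.comp f) where
  map_sup x y := by simp only [MonoidHom.comp_apply, hf.map_sup, hg.map_sup]
  map_inf x y := by simp only [MonoidHom.comp_apply, hf.map_inf, hg.map_inf]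

theorem IsLHom.monotone {f : H →* K} (hf : IsLHom f) : Monotone f := fun x y hxy => by
  rw [← sup_eq_right, ← hf.map_sup, sup_eq_right.mpr hxy]

theorem isLHom_of_monotone {T : Type u} [Group T] [LinearOrder T] {f : T →* K} (hf : Monotone f) :
    IsLHom f :=
  ⟨fun _ _ => hf.map_sup _ _, fun _ _ => hf.map_inf _ _⟩

theorem isLHom_conj [MulLeftMono H] [MulRightMono H] (z : H) :
    IsLHom (MulAut.conj z).toMonoidHom where
  map_sup x y := by simp [mul_sup, sup_mul]
  map_inf x y := by simp [mul_inf, inf_mul]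

end LHom

/-- The limit of a family of subgroups along an ultrafilter. -/
def ultralimit {ι : Type v} {H : Type u} [Group H] (U : Ultrafilter ι) (K : ι → Subgroup H) :
    Subgroup H where
  carrier := {x | ∀ᶠ i in U, x ∈ K i}
  one_mem' := Filter.Eventually.of_forall fun i => (K i).one_mem
  mul_mem' hx hy := by filter_upwards [hx, hy] with i hxi hyi using (K i).mul_mem hxi hyi
  inv_mem' hx := by filter_upwards [hx] with i hxi using (K i).inv_mem hxi

theorem mem_ultralimit {ι : Type v} {H : Type u} [Group H] {U : Ultrafilter ι}
    {K : ι → Subgroup H} {x : H} : x ∈ ultralimit U K ↔ ∀ᶠ i in U, x ∈ K i :=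
  Iff.rfl

section PrimeOrTop

variable {H : Type u} [Group H] [Lattice H]

/-- A convex ℓ-subgroup that contains one of any two disjoint elements. These are the prime
subgroups of `H` together with `H` itself; admitting `H` makes the notion stable under preimages
and ultralimits. -/
structure IsPrimeOrTop (K : Subgroup H) : Prop extends IsConvexLSubgroup K where
  mem_or_mem : ∀ {x y}, x ⊓ y = 1 → x ∈ K ∨ y ∈ K

theorem IsConvexLSubgroup.comap {H' : Type v} [Group H'] [Lattice H'] {K : Subgroup H'}
    (hK : IsConvexLSubgroup K) {f : H →* H'} (hf : IsLHom f) : IsConvexLSubgroup (K.comap f) where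
  sup_mem {x y} hx hy := by
    rw [Subgroup.mem_comap, hf.map_sup]
    exact hK.sup_mem hx hy
  inf_mem {x y} hx hy := by
    rw [Subgroup.mem_comap, hf.map_inf]
    exact hK.inf_mem hx hy
  convex hx hz hxy hyz := hK.convex hx hz (hf.monotone hxy) (hf.monotone hyz)

theorem IsPrimeOrTop.comap {H' : Type v} [Group H'] [Lattice H'] {K : Subgroup H'}
    (hK : IsPrimeOrTop K) {f : H →* H'} (hf : IsLHom f) : IsPrimeOrTop (K.comap f) where
  toIsConvexLSubgroup := hK.toIsConvexLSubgroup.comap hf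
  mem_or_mem {x y} hxy := hK.mem_or_mem (by rw [← hf.map_inf, hxy, map_one])

theorem isPrimeOrTop_bot {T : Type u} [Group T] [LinearOrder T] :
    IsPrimeOrTop (⊥ : Subgroup T) where
  sup_mem {x y} hx hy := by
    rw [Subgroup.mem_bot] at *
    rw [hx, hy, sup_idem]
  inf_mem {x y} hx hy := by
    rw [Subgroup.mem_bot] at *
    rw [hx, hy, inf_idem]
  convex hx hz hxy hyz := by
    rw [Subgroup.mem_bot] at *
    exact le_antisymm (hyz.trans hz.le) (hx.ge.trans hxy)
  mem_or_mem {x y} hxy :=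
    (min_choice x y).imp (fun h => h.symm.trans hxy) (fun h => h.symm.trans hxy)

theorem IsPrimeOrTop.ultralimit {ι : Type v} (U : Ultrafilter ι) {K : ι → Subgroup H}
    (hK : ∀ i, IsPrimeOrTop (K i)) : IsPrimeOrTop (ultralimit U K) where
  sup_mem hx hy := by
    filter_upwards [mem_ultralimit.mp hx, mem_ultralimit.mp hy] with i hxi hyi
      using (hK i).sup_mem hxi hyi
  inf_mem hx hy := by
    filter_upwards [mem_ultralimit.mp hx, mem_ultralimit.mp hy] with i hxi hyi
      using (hK i).inf_mem hxi hyi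
  convex hx hz hxy hyz := by
    filter_upwards [mem_ultralimit.mp hx, mem_ultralimit.mp hz] with i hxi hzi
      using (hK i).convex hxi hzi hxy hyz
  mem_or_mem hxy :=
    Ultrafilter.eventually_or.mp (Filter.Eventually.of_forall fun i => (hK i).mem_or_mem hxy)

variable [MulLeftMono H] [MulRightMono H]

theorem IsPrimeSubgroup.isPrimeOrTop {K : Subgroup H} (hK : IsPrimeSubgroup K) :
    IsPrimeOrTop K where
  toIsConvexLSubgroup := hK.toIsConvexLSubgroup
  mem_or_mem {x y} hxy := by
    have hx : 1 ≤ x := hxy ▸ inf_le_left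
    have hy : 1 ≤ y := hxy ▸ inf_le_right
    rw [← hK.inf_mabs_mem_iff, mabs_of_one_le hx, mabs_of_one_le hy, hxy]
    exact K.one_mem

theorem IsPrimeOrTop.sup_one_mem_or {K : Subgroup H} (hK : IsPrimeOrTop K) (z : H) :
    z ⊔ 1 ∈ K ∨ z⁻¹ ⊔ 1 ∈ K :=
  hK.mem_or_mem (oneLePart_inf_leOnePart_eq_one z)

theorem IsPrimeOrTop.isPrimeSubgroup {K : Subgroup H} (hK : IsPrimeOrTop K) (hne : K ≠ ⊤) :
    IsPrimeSubgroup K where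
  toIsConvexLSubgroup := hK.toIsConvexLSubgroup
  proper := hne
  total x y := by
    have cosetLE_of_mem : ∀ {a b : H}, a * b⁻¹ ⊔ 1 ∈ K → CosetLE K a b := fun h =>
      ⟨_, h, mul_inv_le_iff_le_mul.mp le_sup_left⟩
    have h := hK.sup_one_mem_or (x * y⁻¹)
    rw [mul_inv_rev, inv_inv] at h
    exact h.imp cosetLE_of_mem cosetLE_of_mem

theorem IsPrimeOrTop.mk_sup_eq_or {K : Subgroup H} (hK : IsPrimeOrTop K) (x y : H) :
    ((x ⊔ y : H) : H ⧸ K) = x ∨ ((x ⊔ y : H) : H ⧸ K) = y := by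
  have hx : x * ((y⁻¹ * x)⁻¹ ⊔ 1) = x ⊔ y := by rw [mul_sup]; simp [sup_comm]
  have hy : y * (y⁻¹ * x ⊔ 1) = x ⊔ y := by rw [mul_sup]; simp
  refine (hK.sup_one_mem_or (y⁻¹ * x)).symm.imp (fun h => ?_) (fun h => ?_)
  · rw [← hx, QuotientGroup.mk_mul_of_mem x h]
  · rw [← hy, QuotientGroup.mk_mul_of_mem y h]

theorem IsPrimeOrTop.mk_inf_eq_or {K : Subgroup H} (hK : IsPrimeOrTop K) (x y : H) :
    ((x ⊓ y : H) : H ⧸ K) = x ∨ ((x ⊓ y : H) : H ⧸ K) = y := by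
  have hx : x * ((x⁻¹ * y)⁻¹ ⊔ 1)⁻¹ = x ⊓ y := by
    rw [inv_sup, inv_inv, inv_one, mul_inf, mul_inv_cancel_left, mul_one, inf_comm]
  have hy : y * (x⁻¹ * y ⊔ 1)⁻¹ = x ⊓ y := by rw [inv_sup, mul_inf]; simp
  refine (hK.sup_one_mem_or (x⁻¹ * y)).symm.imp (fun h => ?_) (fun h => ?_)
  · rw [← hx, QuotientGroup.mk_mul_of_mem x (K.inv_mem h)]
  · rw [← hy, QuotientGroup.mk_mul_of_mem y (K.inv_mem h)]

theorem IsPrimeOrTop.normalCore {K : Subgroup H} (hK : IsPrimeOrTop K)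
    (hH : ∀ x y z : H, x ⊓ y = 1 → x ⊓ z * y * z⁻¹ = 1) : IsPrimeOrTop K.normalCore where
  sup_mem hx hy z := ((hK.comap (isLHom_conj z)).sup_mem (hx z) (hy z) :)
  inf_mem hx hy z := ((hK.comap (isLHom_conj z)).inf_mem (hx z) (hy z) :)
  convex hx hy hxy hyz z := ((hK.comap (isLHom_conj z)).convex (hx z) (hy z) hxy hyz :)
  mem_or_mem {x y} hxy := by
    by_contra! h
    obtain ⟨⟨a, ha⟩, ⟨b, hb⟩⟩ : (∃ a, a * x * a⁻¹ ∉ K) ∧ ∃ b, b * y * b⁻¹ ∉ K :=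
      ⟨not_forall.mp h.1, not_forall.mp h.2⟩
    refine not_or_intro ha hb (hK.mem_or_mem ?_)
    calc a * x * a⁻¹ ⊓ b * y * b⁻¹
        = a * (x ⊓ (a⁻¹ * b) * y * (a⁻¹ * b)⁻¹) * a⁻¹ := by
          rw [mul_inf, inf_mul]; congr 1; group
      _ = 1 := by rw [hH x y _ hxy, mul_one, mul_inv_cancel]

end PrimeOrTop

section Existence

variable {H : Type u} [Group H] [Lattice H] [MulLeftMono H] [MulRightMono H]

theorem mul_inv_sup_one_mul_inf (a x : H) : (x * a⁻¹ ⊔ 1) * (a ⊓ x) = x := by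
  have h : x * a⁻¹ ⊔ 1 = x * (a ⊓ x)⁻¹ := by rw [inv_inf, mul_sup, mul_inv_cancel]
  rw [h, inv_mul_cancel_right]

theorem inf_sup_le_sup_inf (a b c : H) : a ⊓ (b ⊔ c) ≤ a ⊓ b ⊔ a ⊓ c := by
  have le_mul : ∀ x ≤ b ⊔ c, a ⊓ x ≤ a ⊓ b ⊔ a ⊓ c →
      x ≤ ((b ⊔ c) * a⁻¹ ⊔ 1) * (a ⊓ b ⊔ a ⊓ c) := fun x hx hax => calc
    x = (x * a⁻¹ ⊔ 1) * (a ⊓ x) := (mul_inv_sup_one_mul_inf a x).symm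
    _ ≤ _ := mul_le_mul' (sup_le_sup_right (mul_le_mul_left hx _) _) hax
  refine (mul_le_mul_iff_left ((b ⊔ c) * a⁻¹ ⊔ 1)).mp ?_
  rw [mul_inv_sup_one_mul_inf]
  exact sup_le (le_mul b le_sup_left le_sup_left) (le_mul c le_sup_right le_sup_right)

theorem one_lt_mabs {g : H} (hg : g ≠ 1) : 1 < |g|ₘ :=
  lt_of_le_of_ne (one_le_mabs g) fun h => hg <| le_antisymm (h ▸ le_mabs_self g)
    (inv_le_one'.mp (h ▸ inv_le_mabs g))

open Pointwise in
theorem isPrimeOrTop_stabilizer {I : Order.Ideal H} (hI : I.IsPrime) :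
    IsPrimeOrTop (MulAction.stabilizer H (I : Set H)) where
  sup_mem {x y} hx hy := by
    rw [MulAction.mem_stabilizer_set] at *
    intro b
    simp only [smul_eq_mul, sup_mul, SetLike.mem_coe, Order.Ideal.sup_mem_iff] at *
    rw [hx, hy, and_self]
  inf_mem {x y} hx hy := by
    rw [MulAction.mem_stabilizer_set] at *
    intro b
    simp only [smul_eq_mul, inf_mul, SetLike.mem_coe] at *
    refine ⟨fun h => ?_, fun h => I.lower (inf_le_left) ((hx b).mpr h)⟩
    exact (hI.mem_or_mem h).elim (hx b).mp (hy b).mp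
  convex {x y z} hx hz hxy hyz := by
    rw [MulAction.mem_stabilizer_set] at *
    exact fun b => ⟨fun h => (hx b).mp (I.lower (mul_le_mul_left hxy b) h),
      fun h => I.lower (mul_le_mul_left hyz b) ((hz b).mpr h)⟩
  mem_or_mem {x y} hxy := by
    have exists_mul_notMem : ∀ {z : H}, 1 ≤ z → z ∉ MulAction.stabilizer H (I : Set H) →
        ∃ b ∈ I, z * b ∉ I := fun {z} hz h => by
      by_contra! hcon
      exact h (MulAction.mem_stabilizer_set.mpr fun b =>
        ⟨I.lower (le_mul_of_one_le_left' hz), hcon b⟩)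
    by_contra! h
    obtain ⟨b, hb, hxb⟩ := exists_mul_notMem (hxy ▸ inf_le_left) h.1
    obtain ⟨c, hc, hyc⟩ := exists_mul_notMem (hxy ▸ inf_le_right) h.2
    have hd : x * (b ⊔ c) ⊓ y * (b ⊔ c) ∈ I := by
      rw [← inf_mul, hxy, one_mul]
      exact Order.Ideal.sup_mem hb hc
    rcases hI.mem_or_mem hd with h | h
    · exact hxb (I.lower (mul_le_mul_right le_sup_left x) h)
    · exact hyc (I.lower (mul_le_mul_right le_sup_right y) h)

open Order Pointwise in
theorem exists_isPrimeOrTop_notMem {g : H} (hg : g ≠ 1) :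
    ∃ K : Subgroup H, IsPrimeOrTop K ∧ g ∉ K := by
  let _ : DistribLattice H := DistribLattice.ofInfSupLe inf_sup_le_sup_inf
  have hdisj : Disjoint (PFilter.principal |g|ₘ : Set H) (Ideal.principal (1 : H)) :=
    Set.disjoint_left.mpr fun a ha ha' => (one_lt_mabs hg).not_ge (le_trans ha ha')
  obtain ⟨I, hI, hle, hgI⟩ := DistribLattice.prime_ideal_of_disjoint_filter_ideal hdisj
  have h1 : 1 ∈ I := hle Ideal.mem_principal_self
  have hgI : |g|ₘ ∉ I := Set.disjoint_left.mp hgI (PFilter.mem_principal.mpr le_rfl)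
  have hK := isPrimeOrTop_stabilizer hI
  refine ⟨_, hK, fun h => hgI ?_⟩
  simpa using (MulAction.mem_stabilizer_set.mp (hK.mabs_mem_iff.mpr h) 1).mpr h1

end Existence

section Automorphisms

variable {A : Type u} [LinearOrder A]

/-- The order automorphisms of a chain form a lattice for the pointwise order. -/
noncomputable instance : Lattice (A ≃o A) where
  toPartialOrder := PartialOrder.lift (fun f : A ≃o A => (f : A → A)) DFunLike.coe_injective
  sup f g := StrictMono.orderIsoOfSurjective (f ⊔ g)
    (fun _ _ h => max_lt_max (f.strictMono h) (g.strictMono h)) fun b => by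
    rcases le_total (f.symm b) (g.symm b) with h | h
    · exact ⟨f.symm b, by simpa using g.le_symm_apply.mp h⟩
    · exact ⟨g.symm b, by simpa using f.le_symm_apply.mp h⟩
  inf f g := StrictMono.orderIsoOfSurjective (f ⊓ g)
    (fun _ _ h => min_lt_min (f.strictMono h) (g.strictMono h)) fun b => by
    rcases le_total (f.symm b) (g.symm b) with h | h
    · exact ⟨g.symm b, by simpa using f.symm_apply_le.mp h⟩
    · exact ⟨f.symm b, by simpa using g.symm_apply_le.mp h⟩
  le_sup_left _ _ _ := le_sup_left
  le_sup_right _ _ _ := le_sup_right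
  sup_le _ _ _ hf hg a := sup_le (hf a) (hg a)
  inf_le_left _ _ _ := inf_le_left
  inf_le_right _ _ _ := inf_le_right
  le_inf _ _ _ hf hg a := le_inf (hf a) (hg a)

theorem orderIso_sup_apply (f g : A ≃o A) (a : A) : (f ⊔ g) a = f a ⊔ g a := rfl

theorem orderIso_inf_apply (f g : A ≃o A) (a : A) : (f ⊓ g) a = f a ⊓ g a := rfl

instance : MulLeftMono (A ≃o A) := ⟨fun f _ _ h a => f.monotone (h a)⟩

instance : MulRightMono (A ≃o A) := ⟨fun f _ _ h a => h (f a)⟩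

theorem isPrimeOrTop_orderIso_stabilizer (a : A) :
    IsPrimeOrTop (MulAction.stabilizer (A ≃o A) a) where
  sup_mem {f g} hf hg := by
    simp only [MulAction.mem_stabilizer_iff, RelIso.smul_def] at *
    rw [orderIso_sup_apply, hf, hg, sup_idem]
  inf_mem {f g} hf hg := by
    simp only [MulAction.mem_stabilizer_iff, RelIso.smul_def] at *
    rw [orderIso_inf_apply, hf, hg, inf_idem]
  convex {f g h} hf hh hfg hgh := by
    simp only [MulAction.mem_stabilizer_iff, RelIso.smul_def] at *
    exact le_antisymm ((hgh a).trans hh.le) (hf.ge.trans (hfg a))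
  mem_or_mem {f g} hfg := by
    have ha : f a ⊓ g a = a := DFunLike.congr_fun hfg a
    exact (min_choice (f a) (g a)).imp (fun h => h.symm.trans ha) (fun h => h.symm.trans ha)

end Automorphisms

section CosetChain

variable {H : Type u} [Group H] [Lattice H] {K : Subgroup H}

/-- The order of the left cosets of `K`: `q ≤ r` when each element of `q` lies below some element
of `r`. -/
@[reducible]
def cosetPreorder (K : Subgroup H) : Preorder (H ⧸ K) where
  le q r := ∀ x : H, (x : H ⧸ K) = q → ∃ y : H, (y : H ⧸ K) = r ∧ x ≤ y
  le_refl _ x hx := ⟨x, hx, le_rfl⟩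
  le_trans _ _ _ hqr hrs x hx :=
    let ⟨_, hy, hxy⟩ := hqr x hx
    let ⟨z, hz, hyz⟩ := hrs _ hy
    ⟨z, hz, hxy.trans hyz⟩

theorem mk_monotone [MulRightMono H] (K : Subgroup H) :
    @Monotone _ _ _ (cosetPreorder K) ((↑) : H → H ⧸ K) := fun x y hxy x' hx' =>
  ⟨y * (x⁻¹ * x'), QuotientGroup.mk_mul_of_mem y (QuotientGroup.eq.mp hx'.symm),
    (mul_inv_cancel_left x x').ge.trans (mul_le_mul_left hxy _)⟩

variable [MulLeftMono H] [MulRightMono H]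

/-- The left cosets of a prime subgroup form a chain. -/
@[reducible]
noncomputable def IsPrimeOrTop.cosetLinearOrder (hK : IsPrimeOrTop K) : LinearOrder (H ⧸ K) where
  toPreorder := cosetPreorder K
  le_antisymm q r hqr hrq := by
    obtain ⟨x, rfl⟩ := QuotientGroup.mk_surjective q
    obtain ⟨y, rfl, hxy⟩ := hqr x rfl
    obtain ⟨z, hz, hyz⟩ := hrq y rfl
    refine QuotientGroup.eq.mpr (hK.convex K.one_mem (QuotientGroup.eq.mp hz.symm) ?_ ?_)
    · exact le_inv_mul_iff_mul_le.mpr (by rwa [mul_one])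
    · exact mul_le_mul_right hyz _
  le_total q r := by
    obtain ⟨x, rfl⟩ := QuotientGroup.mk_surjective q
    obtain ⟨y, rfl⟩ := QuotientGroup.mk_surjective r
    refine (hK.mk_sup_eq_or x y).symm.imp (fun h => ?_) (fun h => ?_)
    · exact h ▸ mk_monotone K le_sup_left
    · exact h ▸ mk_monotone K le_sup_right
  toDecidableLE := Classical.decRel _

theorem IsPrimeOrTop.mk_sup (hK : IsPrimeOrTop K) (x y : H) :
    let _ := hK.cosetLinearOrder
    ((x ⊔ y : H) : H ⧸ K) = (x : H ⧸ K) ⊔ (y : H ⧸ K) := by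
  let _ := hK.cosetLinearOrder
  refine le_antisymm ?_ ((mk_monotone K).le_map_sup x y)
  exact (hK.mk_sup_eq_or x y).elim (fun h => h.le.trans le_sup_left)
    (fun h => h.le.trans le_sup_right)

theorem IsPrimeOrTop.mk_inf (hK : IsPrimeOrTop K) (x y : H) :
    let _ := hK.cosetLinearOrder
    ((x ⊓ y : H) : H ⧸ K) = (x : H ⧸ K) ⊓ (y : H ⧸ K) := by
  let _ := hK.cosetLinearOrder
  refine le_antisymm ((mk_monotone K).map_inf_le x y) ?_
  exact (hK.mk_inf_eq_or x y).elim (fun h => inf_le_left.trans h.ge)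
    (fun h => inf_le_right.trans h.ge)

theorem IsPrimeOrTop.smul_mono (hK : IsPrimeOrTop K) (x : H) {q r : H ⧸ K}
    (hqr : hK.cosetLinearOrder.le q r) : hK.cosetLinearOrder.le (x • q) (x • r) := by
  obtain ⟨y, rfl⟩ := QuotientGroup.mk_surjective q
  obtain ⟨z, rfl, hyz⟩ := hqr y rfl
  exact mk_monotone K (mul_le_mul_right hyz x)

theorem IsPrimeOrTop.exists_chain_action (hK : IsPrimeOrTop K) :
    ∃ (A : Type u) (_ : LinearOrder A) (ρ : H →* (A ≃o A)) (a : A),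
      IsLHom ρ ∧ (MulAction.stabilizer (A ≃o A) a).comap ρ = K := by
  let _ := hK.cosetLinearOrder
  let ρ : H →* (H ⧸ K ≃o H ⧸ K) :=
    { toFun x :=
        { MulAction.toPerm x with
          map_rel_iff' := fun {q r} =>
            ⟨fun h => by simpa using hK.smul_mono x⁻¹ h, hK.smul_mono x⟩ }
      map_one' := OrderIso.ext (funext (one_smul H))
      map_mul' x y := OrderIso.ext (funext (mul_smul x y)) }
  refine ⟨H ⧸ K, _, ρ, (1 : H), ⟨fun x y => ?_, fun x y => ?_⟩, MulAction.stabilizer_quotient K⟩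
  · refine OrderIso.ext (funext (QuotientGroup.mk_surjective.forall.mpr fun z => ?_))
    exact (congrArg _ (sup_mul x y z)).trans (hK.mk_sup _ _)
  · refine OrderIso.ext (funext (QuotientGroup.mk_surjective.forall.mpr fun z => ?_))
    exact (congrArg _ (inf_mul x y z)).trans (hK.mk_inf _ _)

theorem IsPrimeOrTop.exists_chain_quotient (hK : IsPrimeOrTop K) [hn : K.Normal] :
    ∃ (T : Type u) (_ : Group T) (_ : LinearOrder T) (_ : MulLeftMono T) (_ : MulRightMono T)
      (f : H →* T), IsLHom f ∧ Function.Surjective f ∧ f.ker = K := by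
  let _ := hK.cosetLinearOrder
  refine ⟨H ⧸ K, _, _, ⟨fun r p q hpq => ?_⟩, ⟨fun r p q hpq => ?_⟩, QuotientGroup.mk' K,
    ⟨hK.mk_sup, hK.mk_inf⟩, QuotientGroup.mk'_surjective K, QuotientGroup.ker_mk' K⟩
  · obtain ⟨x, rfl⟩ := QuotientGroup.mk_surjective r
    exact hK.smul_mono x hpq
  · obtain ⟨x, rfl⟩ := QuotientGroup.mk_surjective r
    obtain ⟨y, rfl⟩ := QuotientGroup.mk_surjective p
    obtain ⟨z, rfl, hyz⟩ := hpq y rfl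
    exact mk_monotone K (mul_le_mul_left hyz x)

end CosetChain

section Varieties

variable {V : Variety}

theorem isRepresentable_of_linearOrder (T : Type u) [Group T] [LinearOrder T] [MulLeftMono T]
    [MulRightMono T] : IsRepresentable T :=
  ⟨PUnit, fun _ => T, fun _ => inferInstance, fun _ => inferInstance, fun _ => inferInstance,
    fun _ => inferInstance, fun _ => MonoidHom.id T, fun _ => isLHom_of_monotone monotone_id,
    fun _ => Function.surjective_id, fun _ _ h => h PUnit.unit⟩

theorem Variety.Mem.of_surjective {H : Type v} [Group H] [Lattice H] (hH : V.Mem H) {T : Type u}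
    [Group T] [LinearOrder T] [MulLeftMono T] [MulRightMono T] {f : H →* T}
    (hf : Function.Surjective f) : V.Mem T := by
  cases V with
  | all => trivial
  | representable => exact isRepresentable_of_linearOrder T
  | abelian => exact hf.forall₂.mpr fun x y => by rw [← map_mul, hH x y, map_mul]

theorem inf_conj_eq_one_of_linearOrder {T : Type u} [Group T] [LinearOrder T] [MulLeftMono T]
    [MulRightMono T] {x y : T} (hxy : x ⊓ y = 1) (z : T) : x ⊓ z * y * z⁻¹ = 1 := by
  rcases min_choice x y with h | h
  · have hx : x = 1 := h.symm.trans hxy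
    have hy : 1 ≤ y := hxy ▸ inf_le_right
    rw [hx, inf_eq_left]
    simpa using mul_le_mul_left (mul_le_mul_right hy z) z⁻¹
  · have hy : y = 1 := h.symm.trans hxy
    rw [hy, mul_one, mul_inv_cancel, ← hy, hxy, hy]

theorem Variety.Mem.inf_conj_eq_one (hV : V ≠ .all) {H : Type u} [Group H] [Lattice H]
    (hH : V.Mem H) {x y : H} (hxy : x ⊓ y = 1) (z : H) : x ⊓ z * y * z⁻¹ = 1 := by
  cases V with
  | all => exact absurd rfl hV
  | representable =>
    obtain ⟨ι, T, _, _, _, _, f, hf, -, hinj⟩ := id hH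
    refine hinj _ _ fun i => ?_
    have hi : f i x ⊓ f i y = 1 := by rw [← (hf i).map_inf, hxy, map_one]
    simpa only [(hf i).map_inf, map_mul, map_inv, map_one] using
      inf_conj_eq_one_of_linearOrder hi (f i z)
  | abelian => rw [hH z y, mul_inv_cancel_right, hxy]

theorem Variety.Mem.exists_chain_hom_ker_le (hV : V ≠ .all) {H : Type u} [Group H] [Lattice H]
    [MulLeftMono H] [MulRightMono H] (hH : V.Mem H) {K : Subgroup H} (hK : IsPrimeOrTop K) :
    ∃ (T : Type u) (_ : Group T) (_ : LinearOrder T) (_ : MulLeftMono T) (_ : MulRightMono T)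
      (f : H →* T), V.Mem T ∧ IsLHom f ∧ f.ker ≤ K := by
  have hcore := hK.normalCore fun x y z hxy => hH.inf_conj_eq_one hV hxy z
  obtain ⟨T, _, _, _, _, f, hf, hsurj, hker⟩ := hcore.exists_chain_quotient
  exact ⟨T, inferInstance, inferInstance, inferInstance, inferInstance, f,
    hH.of_surjective hsurj, hf, hker.trans_le K.normalCore_le⟩

end Varieties

section Lex

variable {A B : Type u}

instance [Group A] [PartialOrder A] [Group B] [PartialOrder B] [MulLeftMono A] [MulLeftMono B] :
    MulLeftMono (A ×ₗ B) := ⟨fun c x y h => by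
  rw [Prod.Lex.le_iff] at *
  exact h.imp (fun h => mul_lt_mul_right h _)
    (fun h => ⟨congrArg ((ofLex c).1 * ·) h.1, mul_le_mul_right h.2 _⟩)⟩

instance [Group A] [PartialOrder A] [Group B] [PartialOrder B] [MulRightMono A] [MulRightMono B] :
    MulRightMono (A ×ₗ B) := ⟨fun c x y h => by
  rw [Prod.Lex.le_iff] at *
  exact h.imp (fun h => mul_lt_mul_left h _)
    (fun h => ⟨congrArg (· * (ofLex c).1) h.1, mul_le_mul_left h.2 _⟩)⟩

theorem Variety.Mem.lex {V : Variety} [Group A] [LinearOrder A] [MulLeftMono A] [MulRightMono A]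
    [Group B] [LinearOrder B] [MulLeftMono B] [MulRightMono B] (hA : V.Mem A) (hB : V.Mem B) :
    V.Mem (A ×ₗ B) := by
  cases V with
  | all => trivial
  | representable => exact isRepresentable_of_linearOrder (A ×ₗ B)
  | abelian => exact fun x y => Prod.ext (hA _ _) (hB _ _)

/-- The action of pairs of automorphisms on a lexicographic product of chains, componentwise. -/
def lexProdHom [LinearOrder A] [LinearOrder B] :
    (A ≃o A) × (B ≃o B) →* (A ×ₗ B ≃o A ×ₗ B) where
  toFun f := Prod.Lex.prodLexCongr f.1 f.2
  map_one' := rfl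
  map_mul' _ _ := rfl

theorem lexProdHom_monotone [LinearOrder A] [LinearOrder B] :
    Monotone (lexProdHom (A := A) (B := B)) := fun _ _ hfg x =>
  Prod.Lex.toLex_mono ⟨hfg.1 (ofLex x).1, hfg.2 (ofLex x).2⟩

end Lex

namespace IsFreeOver

variable {V : Variety} {G F : Type u} [Group G] [PartialOrder G] [Group F] [Lattice F]
  [MulLeftMono F] [MulRightMono F] {η : G →* F}

theorem exists_eval_eq (hη : IsFreeOver V η) (x : F) :
    ∃ t : Term G, t.eval η = x := by
  let h := FreeLGroup.lift hη.mem η hη.mono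
  have hh : IsLHom h := FreeLGroup.lift_isLHom hη.mem η hη.mono
  obtain ⟨k, ⟨hk, hkη⟩, -⟩ := hη.lift _ FreeLGroup.mem_variety (FreeLGroup.η V G)
    FreeLGroup.isFreeOver.mono
  have hid : h.comp k = MonoidHom.id F := by
    have hone : IsLHom (MonoidHom.id F) := ⟨fun _ _ => rfl, fun _ _ => rfl⟩
    refine (hη.lift F hη.mem η hη.mono).unique ⟨hh.comp hk, ?_⟩ ⟨hone, rfl⟩
    rw [MonoidHom.comp_assoc, hkη]
    rfl
  obtain ⟨t, ht⟩ := Quotient.exists_rep (k x)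
  exact ⟨t, (congrArg h ht).trans (DFunLike.congr_fun hid x)⟩

@[elab_as_elim]
theorem induction (hη : IsFreeOver V η) {motive : F → Prop}
    (of : ∀ g, motive (η g)) (mul : ∀ x y, motive x → motive y → motive (x * y))
    (inv : ∀ x, motive x → motive x⁻¹) (sup : ∀ x y, motive x → motive y → motive (x ⊔ y))
    (inf : ∀ x y, motive x → motive y → motive (x ⊓ y)) (x : F) : motive x := by
  obtain ⟨t, rfl⟩ := hη.exists_eval_eq x
  induction t with
  | of g => exact of g
  | one => exact (congrArg motive (map_one η)).mp (of 1)
  | mul s t hs ht => exact mul _ _ hs ht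
  | inv s hs => exact inv _ hs
  | sup s t hs ht => exact sup _ _ hs ht
  | inf s t hs ht => exact inf _ _ hs ht

theorem exists_mk_eq (hη : IsFreeOver V η) (x : F) :
    ∀ {K : Subgroup F}, IsPrimeOrTop K → ∃ g, (η g : F ⧸ K) = x := by
  induction x using hη.induction with
  | of g => exact fun _ => ⟨g, rfl⟩
  | mul x y hx hy =>
    intro K hK
    obtain ⟨h, hh⟩ := hy hK
    -- `x` is approximated modulo the conjugate `(η h) K (η h)⁻¹`.
    obtain ⟨g, hg⟩ := hx (hK.comap (isLHom_conj (η h)⁻¹))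
    refine ⟨g * h, ?_⟩
    rw [QuotientGroup.eq] at hh hg ⊢
    simpa [mul_assoc] using K.mul_mem (Subgroup.mem_comap.mp hg) hh
  | inv x hx =>
    intro K hK
    obtain ⟨g, hg⟩ := hx (hK.comap (isLHom_conj x))
    refine ⟨g⁻¹, ?_⟩
    rw [QuotientGroup.eq] at hg ⊢
    simpa [mul_assoc] using K.inv_mem (Subgroup.mem_comap.mp hg)
  | sup x y hx hy =>
    intro K hK
    exact (hK.mk_sup_eq_or x y).elim (fun h => h ▸ hx hK) (fun h => h ▸ hy hK)
  | inf x y hx hy =>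
    intro K hK
    exact (hK.mk_inf_eq_or x y).elim (fun h => h ▸ hx hK) (fun h => h ▸ hy hK)

theorem semiconj (hη : IsFreeOver V η) {A B : Type u}
    [LinearOrder A] [LinearOrder B] {σ : F →* (A ≃o A)} {ρ : F →* (B ≃o B)} (hσ : IsLHom σ)
    (hρ : IsLHom ρ) {π : A → B} (hπ : Monotone π)
    (h : ∀ g, Function.Semiconj π (σ (η g)) (ρ (η g))) (x : F) :
    Function.Semiconj π (σ x) (ρ x) := by
  induction x using hη.induction with
  | of g => exact h g
  | mul x y hx hy =>
    rw [map_mul, map_mul]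
    exact hx.comp_right hy
  | inv x hx =>
    rw [map_inv, map_inv]
    exact hx.inverses_right (σ x).apply_symm_apply (ρ x).symm_apply_apply
  | sup x y hx hy =>
    intro a
    rw [hσ.map_sup, hρ.map_sup, orderIso_sup_apply, orderIso_sup_apply, hπ.map_sup, hx a, hy a]
  | inf x y hx hy =>
    intro a
    rw [hσ.map_inf, hρ.map_inf, orderIso_inf_apply, orderIso_inf_apply, hπ.map_inf, hx a, hy a]

theorem exists_isPrimeOrTop_le_of_all (hη : IsFreeOver .all η) {K : Subgroup F}
    (hK : IsPrimeOrTop K) {g : G} (hg : η g ≠ 1) :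
    ∃ N : Subgroup F, IsPrimeOrTop N ∧ N ≤ K ∧ η g ∉ N := by
  obtain ⟨Q, hQ, hgQ⟩ := exists_isPrimeOrTop_notMem hg
  obtain ⟨A, _, ρ, a, hρ, rfl⟩ := hK.exists_chain_action
  obtain ⟨B, _, σ, b, hσ, rfl⟩ := hQ.exists_chain_action
  have hp : Monotone (lexProdHom.comp ((ρ.prod σ).comp η)) := fun _ _ h =>
    lexProdHom_monotone ⟨hρ.monotone (hη.mono h), hσ.monotone (hη.mono h)⟩
  obtain ⟨τ, ⟨hτ, hτη⟩, -⟩ := hη.lift (A ×ₗ B ≃o A ×ₗ B) trivial _ hp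
  have hτg : ∀ g y, τ (η g) y = toLex (ρ (η g) (ofLex y).1, σ (η g) (ofLex y).2) := fun g y =>
    DFunLike.congr_fun (DFunLike.congr_fun hτη g) y
  have hfst : ∀ x y, (ofLex (τ x y)).1 = ρ x (ofLex y).1 := fun x =>
    hη.semiconj hτ hρ Prod.Lex.monotone_fst_ofLex (fun g y => by rw [hτg]; rfl) x
  refine ⟨_, (isPrimeOrTop_orderIso_stabilizer (toLex (a, b))).comap hτ, fun x hx => ?_,
    fun hgN => hgQ ?_⟩
  · exact (hfst x (toLex (a, b))).symm.trans (congrArg (fun y => (ofLex y).1) hx)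
  · exact congrArg (fun y => (ofLex y).2) ((hτg g (toLex (a, b))).symm.trans hgN)

theorem exists_isPrimeOrTop_le_of_ne_all (hV : V ≠ .all) (hη : IsFreeOver V η) {K : Subgroup F}
    (hK : IsPrimeOrTop K) {g : G} (hg : η g ≠ 1) :
    ∃ N : Subgroup F, IsPrimeOrTop N ∧ N ≤ K ∧ η g ∉ N := by
  obtain ⟨Q, hQ, hgQ⟩ := exists_isPrimeOrTop_notMem hg
  obtain ⟨A, _, _, _, _, α, hA, hα, hαK⟩ := hη.mem.exists_chain_hom_ker_le hV hK
  obtain ⟨B, _, _, _, _, β, hB, hβ, hβQ⟩ := hη.mem.exists_chain_hom_ker_le hV hQ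
  let p : G →* A ×ₗ B := (toLexMulEquiv (A × B)).toMonoidHom.comp ((α.prod β).comp η)
  have hp : Monotone p := fun _ _ h =>
    Prod.Lex.toLex_mono ⟨hα.monotone (hη.mono h), hβ.monotone (hη.mono h)⟩
  obtain ⟨τ, ⟨hτ, hτη⟩, -⟩ := hη.lift (A ×ₗ B) (hA.lex hB) p hp
  let fst : A ×ₗ B →* A := (OrderMonoidHom.fstₗ A B).toMonoidHom
  have hfst : IsLHom fst := isLHom_of_monotone (OrderMonoidHom.fstₗ A B).monotone'
  have hfstτ : fst.comp τ = α :=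
    (hη.lift A hA (α.comp η) (hα.monotone.comp hη.mono)).unique
      ⟨hfst.comp hτ, by rw [MonoidHom.comp_assoc, hτη]; rfl⟩ ⟨hα, rfl⟩
  refine ⟨_, isPrimeOrTop_bot.comap hτ, fun x hx => hαK ?_, fun hgN => hgQ (hβQ ?_)⟩
  · rw [MonoidHom.mem_ker, ← hfstτ, MonoidHom.comp_apply, Subgroup.mem_bot.mp hx, map_one]
  · have hpg : p g = 1 := (DFunLike.congr_fun hτη g).symm.trans hgN
    exact congrArg (fun y => (ofLex y).2) hpg

theorem exists_isPrimeOrTop_le (hη : IsFreeOver V η) {K : Subgroup F} (hK : IsPrimeOrTop K)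
    {g : G} (hg : η g ≠ 1) : ∃ N : Subgroup F, IsPrimeOrTop N ∧ N ≤ K ∧ η g ∉ N := by
  by_cases hV : V = .all
  · subst hV
    exact exists_isPrimeOrTop_le_of_all hη hK hg
  · exact exists_isPrimeOrTop_le_of_ne_all hV hη hK hg

theorem isMin_iff_disjoint (hη : IsFreeOver V η) {𝔭 : Spec F} :
    IsMin 𝔭 ↔ Disjoint (Set.range η \ {1}) (𝔭.1 : Set F) := by
  rw [Set.disjoint_left]
  constructor
  · rintro hmin _ ⟨⟨g, rfl⟩, hg⟩ hg𝔭
    obtain ⟨N, hN, hle, hgN⟩ := hη.exists_isPrimeOrTop_le 𝔭.2.isPrimeOrTop hg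
    have hNprime := hN.isPrimeSubgroup fun h => hgN (h ▸ Subgroup.mem_top _)
    exact hgN (hmin (show (⟨N, hNprime⟩ : Spec F) ≤ 𝔭 from hle) hg𝔭)
  · intro hdisj 𝔮 hle x hx
    obtain ⟨g, hg⟩ := hη.exists_mk_eq x 𝔮.2.isPrimeOrTop
    rw [QuotientGroup.eq] at hg
    have hg𝔭 : η g ∈ 𝔭.1 := by simpa using 𝔭.1.mul_mem hx (𝔭.1.inv_mem (hle hg))
    have hg1 : η g = 1 := by
      by_contra hne
      exact hdisj ⟨⟨g, rfl⟩, hne⟩ hg𝔭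
    simpa [hg1] using hg

theorem exists_apply_notMem (hη : IsFreeOver V η) (𝔭 : Spec F) : ∃ g, η g ∉ 𝔭.1 := by
  obtain ⟨x, -, hx⟩ := SetLike.exists_of_lt (lt_top_iff_ne_top.mpr 𝔭.2.proper)
  obtain ⟨g, hg⟩ := hη.exists_mk_eq x 𝔭.2.isPrimeOrTop
  have hgx : (η g)⁻¹ * x ∈ 𝔭.1 := QuotientGroup.eq.mp hg
  exact ⟨g, fun hg𝔭 => hx ((𝔭.1.mul_mem_cancel_left (𝔭.1.inv_mem hg𝔭)).mp hgx)⟩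

end IsFreeOver

theorem Spec.isCompact_setOf_disjoint {H : Type u} [Group H] [Lattice H] [MulLeftMono H]
    [MulRightMono H] {S : Set H} (hS : S.Nonempty) :
    IsCompact {𝔭 : Spec H | Disjoint S (𝔭.1 : Set H)} := by
  rw [isCompact_iff_ultrafilter_le_nhds]
  intro U hU
  let L : Subgroup H := ultralimit U fun 𝔭 : Spec H => 𝔭.1
  have hL : IsPrimeOrTop L := IsPrimeOrTop.ultralimit U fun 𝔭 => 𝔭.2.isPrimeOrTop
  have hdisj : Disjoint S (L : Set H) := Set.disjoint_left.mpr fun x hxS hxL => by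
    obtain ⟨𝔭, hx𝔭, h𝔭⟩ := (hxL.and (Filter.le_principal_iff.mp hU)).exists
    exact Set.disjoint_left.mp h𝔭 hxS hx𝔭
  obtain ⟨x, hxS⟩ := hS
  have hne : L ≠ ⊤ := fun h => Set.disjoint_left.mp hdisj hxS (h ▸ Subgroup.mem_top x)
  refine ⟨⟨L, hL.isPrimeSubgroup hne⟩, hdisj, le_nhds_iff.mpr ?_⟩
  rintro _ hLA ⟨A, rfl⟩
  obtain ⟨a, ha, haL⟩ := Set.not_subset.mp hLA
  filter_upwards [Ultrafilter.eventually_not.mpr haL] with 𝔭 ha𝔭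
  exact Set.not_subset.mpr ⟨a, ha, ha𝔭⟩

end LGrp

theorem theorem6p8_general {V : LGrp.Variety} {G F : Type u} [Group G] [PartialOrder G]
    [Group F] [Lattice F] [MulLeftMono F] [MulRightMono F] {η : G →* F}
    (hη : LGrp.IsFreeOver V η) : CompactSpace (LGrp.MinSpec F) := by
  obtain _ | ⟨⟨𝔭, -⟩⟩ := isEmpty_or_nonempty (LGrp.MinSpec F)
  · infer_instance
  obtain ⟨g, hg⟩ := hη.exists_apply_notMem 𝔭
  have hne : (Set.range η \ {1}).Nonempty :=
    ⟨η g, ⟨g, rfl⟩, fun h => hg (h ▸ 𝔭.1.one_mem)⟩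
  have hcompact : IsCompact {𝔭 : LGrp.Spec F | IsMin 𝔭} := by
    simpa only [hη.isMin_iff_disjoint] using LGrp.Spec.isCompact_setOf_disjoint hne
  exact isCompact_iff_compactSpace.mp hcompact

theorem theorem6p8 (V : LGrp.Variety) (G : Type u) [Group G] [PartialOrder G]
    [MulLeftMono G] [MulRightMono G] :
    CompactSpace (LGrp.MinSpec (LGrp.FreeLGroup V G)) :=
  theorem6p8_general LGrp.FreeLGroup.isFreeOver
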